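/- Let $\mathbb D$ be the open unit disk, let $\rho(z,w)=\left|\frac{z-w}{1-\bar z w}\right|$ be the pseudohyperbolic distance in $\mathbb D$, and let $\operatorname{Har}_+(\mathbb D)$ be the cone of positive (that is, $H\ge 0$) harmonic functions on $\mathbb D$. Let $N$ be the Nevanlinna class, consisting of the holomorphic functions $f$ on $\mathbb D$ for which there is $H\in\operatorname{Har}_+(\mathbb D)$ with $\log_+|f|\le H$ on $\mathbb D$. A sequence $\Lambda=\{\lambda_n\}_{n\in\mathbb N}\subset\mathbb D$ is called Nevanlinna interpolating if its trace space $N|\Lambda=\{\{f(\lambda_n)\}_n : f\in N\}$ is ideal, i.e. stable under pointwise multiplication by bounded sequences of complex numbers. Let $\Lambda=\{\lambda_n\}_{n\in\mathbb N}\subset\mathbb D$ be a Nevanlinna interpolating sequence and let $H\in\operatorname{Har}_+(\mathbb D)$ satisfy $$\prod_{k:\,k\ne n}\rho(\lambda_k,\lambda_n)\ \ge\ e^{-H(\lambda_n)},\qquad n\in\mathbb N.$$ (The left-hand side is $|B_n(\lambda_n)|=(1-|\lambda_n|^2)|B'(\lambda_n)|$, where $B$ and $B_n$ are the Blaschke products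 with zeros $\{\lambda_k\}_k$ and $\{\lambda_k\}_{k\ne n}$, respectively.) If $\Lambda'=\{\lambda_n'\}_{n\in\mathbb N}\subset\mathbb D$ satisfies $$\rho(\lambda_n,\lambda_n')\ \le\ \tfrac14\,e^{-H(\lambda_n)},\qquad n\in\mathbb N,$$ then $\Lambda'$ is also a Nevanlinna interpolating sequence. -/

import Mathlib

open Metric

/-- The open unit disk of the complex plane. -/
abbrev unitDisk : Set ℂ := ball (0 : ℂ) 1

/-- `IsPosHarmonic H`: the restriction of `H` to the unit disk is a positive harmonic function,
i.e. `H ∈ Har₊(𝔻)`. Positivity is `0 ≤ H`: the cone consists of the Poisson integrals of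
positive measures on the circle, the zero measure included. -/
def IsPosHarmonic (H : ℂ → ℝ) : Prop :=
  InnerProductSpace.HarmonicOnNhd H unitDisk ∧ ∀ z ∈ unitDisk, 0 ≤ H z

/-- The Nevanlinna class `N`: holomorphic functions `f` on the unit disk such that `log⁺ |f|`
has a positive harmonic majorant there. (Values outside the disk are irrelevant.) -/
def nevanlinnaClass : Set (ℂ → ℂ) :=
  {f | DifferentiableOn ℂ f unitDisk ∧
    ∃ H : ℂ → ℝ, IsPosHarmonic H ∧ ∀ z ∈ unitDisk, Real.posLog ‖f z‖ ≤ H z}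

/-- The trace space `N|Λ`: all sequences `(f (Λ n))_n` with `f ∈ N`. -/
def nevanlinnaTrace (Λ : ℕ → ℂ) : Set (ℕ → ℂ) :=
  {w | ∃ f ∈ nevanlinnaClass, ∀ n, w n = f (Λ n)}

/-- A set of sequences is ideal if it is stable under pointwise multiplication by bounded
sequences. -/
def IsIdealSequenceSpace (S : Set (ℕ → ℂ)) : Prop :=
  ∀ v : ℕ → ℂ, (∃ C : ℝ, ∀ n, ‖v n‖ ≤ C) → ∀ w ∈ S, (fun n => v n * w n) ∈ S

/-- A sequence of points of the unit disk is interpolating for the Nevanlinna class if its trace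
space is ideal. -/
def IsNevanlinnaInterpolating (Λ : ℕ → ℂ) : Prop :=
  (∀ n, Λ n ∈ unitDisk) ∧ IsIdealSequenceSpace (nevanlinnaTrace Λ)

/-- The pseudohyperbolic distance `ρ(z, w) = |(z - w) / (1 - z̄ w)|`. -/
noncomputable def pseudohyperbolicDist (z w : ℂ) : ℝ :=
  ‖(z - w) / (1 - (starRingEnd ℂ) z * w)‖

/-- `|B_n(Λ n)| = ∏_{k ≠ n} ρ(Λ k, Λ n)`, where `B_n` is the Blaschke product with zeros `Λ k`,
`k ≠ n`. For points of the disk all the factors lie in `[0, 1)`, so the finite subproducts decrease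
and the infinite product always converges unconditionally, possibly to `0`. -/
noncomputable def blaschkeModulusOmit (Λ : ℕ → ℂ) (n : ℕ) : ℝ :=
  ∏' k : {k : ℕ // k ≠ n}, pseudohyperbolicDist (Λ k) (Λ n)

open scoped ComplexConjugate

/-! A lower bound `exp (-H)` on the omitted Blaschke products suffices for interpolation
(`isNevanlinnaInterpolating_of_exp_neg_le`): an explicit series of Blaschke products times squared
kernels, multiplied by a zero-free exponential, takes the required values. It remains to transfer
the bound to `Λ'`. Each factor ρ of the product for `Λ` dominates `exp (-H)` at both of its points,
so each point moves by at most ρ/4. The new factor ρ' is then at least ρ/2, and 1 - ρ'² is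
comparable to 1 - ρ²; together these give ρ^8 ≤ ρ' (`pseudohyperbolicDist_pow_eight_le`). Hence the
new product is at least the eighth power of the old one, and Harnack moves `H` from `Λ n` to `Λ' n`.
-/

/-! ### Pseudohyperbolic geometry and perturbation of distances. -/

lemma one_sub_conj_mul_ne_zero {z w : ℂ} (hz : z ∈ unitDisk) (hw : w ∈ unitDisk) :
    1 - conj z * w ≠ 0 := by
  intro h
  have h1 : ‖conj z * w‖ = 1 := by rw [← sub_eq_zero.1 h]; simp
  rw [norm_mul, RCLike.norm_conj] at h1
  have := mem_ball_zero_iff.1 hz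
  have := mem_ball_zero_iff.1 hw
  nlinarith [norm_nonneg z, norm_nonneg w]

lemma normSq_one_sub_conj_mul (z w : ℂ) :
    ‖1 - conj z * w‖ ^ 2 = ‖z - w‖ ^ 2 + (1 - ‖z‖ ^ 2) * (1 - ‖w‖ ^ 2) := by
  simp only [← Complex.normSq_eq_norm_sq, Complex.normSq_apply, Complex.sub_re, Complex.sub_im,
    Complex.one_re, Complex.one_im, Complex.mul_re, Complex.mul_im, Complex.conj_re,
    Complex.conj_im]
  ring

lemma one_sub_pseudohyperbolicDist_sq {z w : ℂ} (hz : z ∈ unitDisk) (hw : w ∈ unitDisk) :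
    1 - pseudohyperbolicDist z w ^ 2 =
      (1 - ‖z‖ ^ 2) * (1 - ‖w‖ ^ 2) / ‖1 - conj z * w‖ ^ 2 := by
  have h := norm_ne_zero_iff.2 (one_sub_conj_mul_ne_zero hz hw)
  have := normSq_one_sub_conj_mul z w
  rw [pseudohyperbolicDist, norm_div, div_pow, eq_div_iff (pow_ne_zero 2 h), sub_mul,
    div_mul_cancel₀ _ (pow_ne_zero 2 h)]
  linarith

lemma pseudohyperbolicDist_nonneg (z w : ℂ) : 0 ≤ pseudohyperbolicDist z w := norm_nonneg _

lemma one_sub_norm_sq_pos {z : ℂ} (hz : z ∈ unitDisk) : 0 < 1 - ‖z‖ ^ 2 := by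
  have := mem_ball_zero_iff.1 hz
  nlinarith [norm_nonneg z]

lemma pseudohyperbolicDist_lt_one {z w : ℂ} (hz : z ∈ unitDisk) (hw : w ∈ unitDisk) :
    pseudohyperbolicDist z w < 1 := by
  have h := norm_pos_iff.2 (one_sub_conj_mul_ne_zero hz hw)
  have h1 : 0 < 1 - pseudohyperbolicDist z w ^ 2 := by
    rw [one_sub_pseudohyperbolicDist_sq hz hw]
    have := one_sub_norm_sq_pos hz
    have := one_sub_norm_sq_pos hw
    positivity
  nlinarith [pseudohyperbolicDist_nonneg z w]

lemma norm_one_sub_conj_mul_comm (z w : ℂ) : ‖1 - conj z * w‖ = ‖1 - conj w * z‖ := by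
  rw [← RCLike.norm_conj]
  simp [mul_comm]

lemma pseudohyperbolicDist_comm (z w : ℂ) :
    pseudohyperbolicDist z w = pseudohyperbolicDist w z := by
  rw [pseudohyperbolicDist, pseudohyperbolicDist, norm_div, norm_div, norm_sub_rev,
    norm_one_sub_conj_mul_comm]

/-- The triangle inequality for the pseudohyperbolic distance, in its sharp form. -/
lemma one_sub_pseudohyperbolicDist_sq_mul_le {a b c : ℂ} (ha : a ∈ unitDisk) (hb : b ∈ unitDisk)
    (hc : c ∈ unitDisk) :
    (1 - pseudohyperbolicDist a c ^ 2) *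
        (1 - pseudohyperbolicDist a b * pseudohyperbolicDist b c) ^ 2 ≤
      (1 - pseudohyperbolicDist a b ^ 2) * (1 - pseudohyperbolicDist b c ^ 2) := by
  have hab := norm_pos_iff.2 (one_sub_conj_mul_ne_zero ha hb)
  have hbc := norm_pos_iff.2 (one_sub_conj_mul_ne_zero hb hc)
  have hac := norm_pos_iff.2 (one_sub_conj_mul_ne_zero ha hc)
  have hA := one_sub_norm_sq_pos ha
  have hB := one_sub_norm_sq_pos hb
  have hC := one_sub_norm_sq_pos hc
  have hs := pseudohyperbolicDist_lt_one ha hb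
  have ht := pseudohyperbolicDist_lt_one hb hc
  have hst : 0 ≤ 1 - pseudohyperbolicDist a b * pseudohyperbolicDist b c := by
    nlinarith [pseudohyperbolicDist_nonneg a b, pseudohyperbolicDist_nonneg b c]
  have key : (1 - pseudohyperbolicDist a b * pseudohyperbolicDist b c) *
      (‖1 - conj a * b‖ * ‖1 - conj b * c‖) ≤ ‖1 - conj a * c‖ * (1 - ‖b‖ ^ 2) := by
    have e1 : (1 - pseudohyperbolicDist a b * pseudohyperbolicDist b c) *
        (‖1 - conj a * b‖ * ‖1 - conj b * c‖) =
        ‖(1 - conj a * b) * (1 - conj b * c)‖ - ‖conj (a - b) * (c - b)‖ := by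
      rw [pseudohyperbolicDist, pseudohyperbolicDist, norm_div, norm_div, norm_mul, norm_mul,
        RCLike.norm_conj, norm_sub_rev c b]
      generalize ‖1 - conj a * b‖ = x at *
      generalize ‖1 - conj b * c‖ = y at *
      field_simp
    have e2 : ‖1 - conj a * c‖ * (1 - ‖b‖ ^ 2) =
        ‖(1 - conj a * b) * (1 - conj b * c) - conj (a - b) * (c - b)‖ := by
      -- This identity turns the claim into the reverse triangle inequality.
      have : (1 - conj a * b) * (1 - conj b * c) - conj (a - b) * (c - b) =
          (1 - conj a * c) * ((1 - ‖b‖ ^ 2 : ℝ) : ℂ) := by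
        push_cast
        rw [← Complex.conj_mul', map_sub]
        ring
      rw [this, norm_mul, Complex.norm_real, Real.norm_of_nonneg hB.le]
    rw [e1, e2]
    exact norm_sub_norm_le _ _
  rw [one_sub_pseudohyperbolicDist_sq ha hc, one_sub_pseudohyperbolicDist_sq ha hb,
    one_sub_pseudohyperbolicDist_sq hb hc, div_mul_div_comm, div_mul_eq_mul_div,
    div_le_div_iff₀ (by positivity) (by positivity)]
  have key2 := pow_le_pow_left₀ (by positivity) key 2
  have := mul_le_mul_of_nonneg_left key2 (mul_pos hA hC).le
  nlinarith [this]

lemma pseudohyperbolicDist_sub_le {a b c : ℂ} (ha : a ∈ unitDisk) (hb : b ∈ unitDisk)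
    (hc : c ∈ unitDisk) :
    pseudohyperbolicDist a b - pseudohyperbolicDist b c ≤ pseudohyperbolicDist a c := by
  have h := one_sub_pseudohyperbolicDist_sq_mul_le ha hb hc
  have hs := pseudohyperbolicDist_lt_one ha hb
  have ht := pseudohyperbolicDist_lt_one hb hc
  have hs0 := pseudohyperbolicDist_nonneg a b
  have ht0 := pseudohyperbolicDist_nonneg b c
  have hr0 := pseudohyperbolicDist_nonneg a c
  generalize pseudohyperbolicDist a b = s at *
  generalize pseudohyperbolicDist b c = t at *
  generalize pseudohyperbolicDist a c = r at *
  have hst : 0 ≤ s * t := by positivity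
  have h1 : (s - t) ^ 2 ≤ (r * (1 - s * t)) ^ 2 := by nlinarith
  have hst1 : 0 ≤ 1 - s * t := by nlinarith
  have h2 := (abs_le_of_sq_le_sq' h1 (by positivity)).2
  nlinarith

/-- The constant is (1 + t)/(1 - t) at t = 1/4. -/
lemma one_sub_pseudohyperbolicDist_sq_le {a b c : ℂ} (ha : a ∈ unitDisk) (hb : b ∈ unitDisk)
    (hc : c ∈ unitDisk) (h : pseudohyperbolicDist b c ≤ 1 / 4) :
    1 - pseudohyperbolicDist a c ^ 2 ≤ 5 / 3 * (1 - pseudohyperbolicDist a b ^ 2) := by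
  have h1 := one_sub_pseudohyperbolicDist_sq_mul_le ha hb hc
  have hs := pseudohyperbolicDist_lt_one ha hb
  have hr := pseudohyperbolicDist_lt_one ha hc
  have hs0 := pseudohyperbolicDist_nonneg a b
  have ht0 := pseudohyperbolicDist_nonneg b c
  have hr0 := pseudohyperbolicDist_nonneg a c
  generalize pseudohyperbolicDist a b = s at *
  generalize pseudohyperbolicDist b c = t at *
  generalize pseudohyperbolicDist a c = r at *
  have hr2 : 0 ≤ 1 - r ^ 2 := by nlinarith
  have hs2 : 0 ≤ 1 - s ^ 2 := by nlinarith
  have h2 : (1 - t) ^ 2 ≤ (1 - s * t) ^ 2 := by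
    apply pow_le_pow_left₀ <;> nlinarith
  have h3 : (1 - r ^ 2) * (1 - t) ^ 2 ≤ (1 - s ^ 2) * ((1 + t) * (1 - t)) := by
    nlinarith [mul_le_mul_of_nonneg_left h2 hr2]
  have h4 : (1 - r ^ 2) * (1 - t) ≤ (1 - s ^ 2) * (1 + t) := by
    apply le_of_mul_le_mul_right _ (show 0 < 1 - t by linarith)
    linarith
  have h5 : 1 + t ≤ 5 / 3 * (1 - t) := by linarith
  apply le_of_mul_le_mul_right _ (show 0 < 1 - t by linarith)
  nlinarith [mul_le_mul_of_nonneg_left h5 hs2]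

/-- Used for squared distances; 25/9 = (5/3)² comes from moving both points. For q ≤ 4/5, (4/5)^7 <
1/4 suffices; near 1, 1 + q + q² + q³ exceeds 25/9. -/
lemma pow_eight_le_of_one_sub_le {q q' : ℝ} (hq0 : 0 ≤ q) (hq1 : q ≤ 1) (h1 : q / 4 ≤ q')
    (h2 : 1 - q' ≤ 25 / 9 * (1 - q)) : q ^ 8 ≤ q' := by
  rcases le_total q (4 / 5) with h | h
  · have : q ^ 7 ≤ (4 / 5) ^ 7 := pow_le_pow_left₀ hq0 h 7
    have : q ^ 8 = q ^ 7 * q := by ring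
    nlinarith
  · have h8 : q ^ 8 ≤ q ^ 4 := pow_le_pow_of_le_one hq0 hq1 (by norm_num)
    have : q ^ 4 ≤ 1 - 25 / 9 * (1 - q) := by
      have e : 1 - 25 / 9 * (1 - q) - q ^ 4 = (1 - q) * (q ^ 3 + q ^ 2 + q - 16 / 9) := by ring
      have h3 : (4 / 5) ^ 3 ≤ q ^ 3 := pow_le_pow_left₀ (by norm_num) h 3
      have h2 : (4 / 5) ^ 2 ≤ q ^ 2 := pow_le_pow_left₀ (by norm_num) h 2
      nlinarith
    linarith

lemma pseudohyperbolicDist_pow_eight_le {a b a' b' : ℂ} (ha : a ∈ unitDisk) (hb : b ∈ unitDisk)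
    (ha' : a' ∈ unitDisk) (hb' : b' ∈ unitDisk)
    (haa : pseudohyperbolicDist a a' ≤ 1 / 4 * pseudohyperbolicDist a b)
    (hbb : pseudohyperbolicDist b b' ≤ 1 / 4 * pseudohyperbolicDist a b) :
    pseudohyperbolicDist a b ^ 8 ≤ pseudohyperbolicDist a' b' := by
  have h1 := pseudohyperbolicDist_lt_one ha hb
  have h0 := pseudohyperbolicDist_nonneg a b
  have h0' := pseudohyperbolicDist_nonneg a' b'
  have t1 := pseudohyperbolicDist_sub_le ha hb hb'
  have t2 := pseudohyperbolicDist_sub_le hb' ha ha'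
  have d1 := one_sub_pseudohyperbolicDist_sq_le ha hb hb' (by linarith)
  have d2 := one_sub_pseudohyperbolicDist_sq_le hb' ha ha' (by linarith)
  rw [pseudohyperbolicDist_comm b' a, pseudohyperbolicDist_comm b' a'] at t2 d2
  have h2 : (pseudohyperbolicDist a b ^ 2) ^ 8 ≤ pseudohyperbolicDist a' b' ^ 2 := by
    apply pow_eight_le_of_one_sub_le
    · positivity
    · nlinarith
    · nlinarith
    · linarith
  rw [← pow_mul, mul_comm, pow_mul] at h2
  exact (sq_le_sq₀ (by positivity) h0').1 h2

/-! ### Infinite products with factors in [0, 1]. -/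

section InfiniteProducts

variable {ι : Type*} {f g : ι → ℝ}

lemma hasProd_iInf_of_nonneg_of_le_one (h0 : ∀ i, 0 ≤ f i) (h1 : ∀ i, f i ≤ 1) :
    HasProd f (⨅ s : Finset ι, ∏ i ∈ s, f i) := by
  rw [HasProd, SummationFilter.unconditional_filter]
  refine tendsto_atTop_ciInf (Finset.prod_anti_set_of_le_one h0 h1) ⟨0, ?_⟩
  rintro _ ⟨s, rfl⟩
  exact Finset.prod_nonneg fun i _ ↦ h0 i

lemma tprod_le_finset_prod (h0 : ∀ i, 0 ≤ f i) (h1 : ∀ i, f i ≤ 1) (s : Finset ι) :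
    ∏' i, f i ≤ ∏ i ∈ s, f i := by
  rw [(hasProd_iInf_of_nonneg_of_le_one h0 h1).tprod_eq]
  refine ciInf_le ⟨0, ?_⟩ s
  rintro _ ⟨s, rfl⟩
  exact Finset.prod_nonneg fun i _ ↦ h0 i

lemma tprod_le_apply (h0 : ∀ i, 0 ≤ f i) (h1 : ∀ i, f i ≤ 1) (i : ι) : ∏' j, f j ≤ f i := by
  simpa using tprod_le_finset_prod h0 h1 {i}

lemma tprod_pow_le_tprod (hf0 : ∀ i, 0 ≤ f i) (hf1 : ∀ i, f i ≤ 1) (hg1 : ∀ i, g i ≤ 1)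
    (n : ℕ) (h : ∀ i, f i ^ n ≤ g i) : (∏' i, f i) ^ n ≤ ∏' i, g i := by
  have hg0 i : 0 ≤ g i := (pow_nonneg (hf0 i) n).trans (h i)
  have hm := hasProd_iInf_of_nonneg_of_le_one hg0 hg1
  rw [hm.tprod_eq]
  refine le_hasProd_of_le_prod hm fun s ↦ ?_
  calc (∏' i, f i) ^ n ≤ (∏ i ∈ s, f i) ^ n :=
        pow_le_pow_left₀ (le_hasProd_of_le_prod
          (hasProd_iInf_of_nonneg_of_le_one hf0 hf1).multipliable.hasProd
          fun s ↦ Finset.prod_nonneg fun i _ ↦ hf0 i) (tprod_le_finset_prod hf0 hf1 s) n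
    _ = ∏ i ∈ s, f i ^ n := (Finset.prod_pow ..).symm
    _ ≤ ∏ i ∈ s, g i := Finset.prod_le_prod (fun i _ ↦ pow_nonneg (hf0 i) n) fun i _ ↦ h i

lemma summable_one_sub_of_tprod_pos (h0 : ∀ i, 0 ≤ f i) (h1 : ∀ i, f i ≤ 1)
    (hpos : 0 < ∏' i, f i) : Summable fun i ↦ 1 - f i := by
  have hf i : 0 < f i := hpos.trans_le (tprod_le_apply h0 h1 i)
  refine summable_of_sum_le (c := -Real.log (∏' i, f i)) (fun i ↦ sub_nonneg.2 (h1 i)) fun s ↦ ?_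
  calc ∑ i ∈ s, (1 - f i) ≤ ∑ i ∈ s, -Real.log (f i) :=
        Finset.sum_le_sum fun i _ ↦ by linarith [Real.log_le_sub_one_of_pos (hf i)]
    _ = -Real.log (∏ i ∈ s, f i) := by
        rw [Finset.sum_neg_distrib, Real.log_prod fun i _ ↦ (hf i).ne']
    _ ≤ _ := neg_le_neg (Real.log_le_log hpos (tprod_le_finset_prod h0 h1 s))

end InfiniteProducts

/-! ### Blaschke products. -/

lemma differentiableOn_unitDisk_of_forall_lt {f : ℂ → ℂ}
    (h : ∀ r < 1, DifferentiableOn ℂ f (ball 0 r)) : DifferentiableOn ℂ f unitDisk := by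
  intro z hz
  obtain ⟨r, hzr, hr⟩ := exists_between (mem_ball_zero_iff.1 hz)
  exact ((h r hr).differentiableAt
    (isOpen_ball.mem_nhds (mem_ball_zero_iff.2 hzr))).differentiableWithinAt

lemma one_sub_le_norm_one_sub_conj_mul {a z : ℂ} (ha : a ∈ unitDisk) {r : ℝ} (hz : ‖z‖ ≤ r) :
    1 - r ≤ ‖1 - conj a * z‖ := by
  have h1 := norm_sub_norm_le 1 (conj a * z)
  rw [norm_one, norm_mul, RCLike.norm_conj] at h1
  nlinarith [mem_ball_zero_iff.1 ha, norm_nonneg z]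

lemma differentiableOn_div_one_sub_conj_mul {a : ℂ} (ha : a ∈ unitDisk) {f : ℂ → ℂ}
    (hf : DifferentiableOn ℂ f unitDisk) :
    DifferentiableOn ℂ (fun z ↦ f z / (1 - conj a * z)) unitDisk :=
  hf.div (by fun_prop) fun _ hz ↦ one_sub_conj_mul_ne_zero ha hz

/-- The unimodular constant normalizing the Blaschke factor with zero `a`. -/
noncomputable def blaschkePhase (a : ℂ) : ℂ := if a = 0 then 1 else conj a / ‖a‖

/-- The normalized Blaschke factor with zero `a`. -/
noncomputable def blaschkeFactor (a z : ℂ) : ℂ := blaschkePhase a * ((a - z) / (1 - conj a * z))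

lemma norm_blaschkePhase (a : ℂ) : ‖blaschkePhase a‖ = 1 := by
  unfold blaschkePhase
  split_ifs with h
  · simp
  · simp [h]

lemma blaschkePhase_mul (a : ℂ) : blaschkePhase a * a = ‖a‖ := by
  unfold blaschkePhase
  split_ifs with h
  · simp [h]
  · have : (‖a‖ : ℂ) ≠ 0 := by simpa
    rw [div_mul_eq_mul_div, Complex.conj_mul']
    field_simp

lemma blaschkePhase_mul_norm (a : ℂ) : blaschkePhase a * ‖a‖ = conj a := by
  unfold blaschkePhase
  split_ifs with h
  · simp [h]
  · have : (‖a‖ : ℂ) ≠ 0 := by simpa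
    field_simp

lemma norm_blaschkeFactor (a z : ℂ) : ‖blaschkeFactor a z‖ = pseudohyperbolicDist a z := by
  rw [blaschkeFactor, norm_mul, norm_blaschkePhase, one_mul, pseudohyperbolicDist]

lemma differentiableOn_blaschkeFactor {a : ℂ} (ha : a ∈ unitDisk) :
    DifferentiableOn ℂ (blaschkeFactor a) unitDisk :=
  (differentiableOn_div_one_sub_conj_mul ha (by fun_prop)).const_mul _

/-- The phase is chosen so that 1 - ‖a‖ factors out of the difference; this makes the product
converge locally uniformly. -/
lemma norm_blaschkeFactor_sub_one_le {a z : ℂ} (ha : a ∈ unitDisk) {r : ℝ} (hr : r < 1)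
    (hz : ‖z‖ ≤ r) : ‖blaschkeFactor a z - 1‖ ≤ 2 / (1 - r) * (1 - ‖a‖) := by
  have hz1 : z ∈ unitDisk := mem_ball_zero_iff.2 (hz.trans_lt hr)
  have hne := one_sub_conj_mul_ne_zero ha hz1
  have e : blaschkeFactor a z - 1 =
      -((1 - ‖a‖ : ℝ) : ℂ) * (1 + blaschkePhase a * z) / (1 - conj a * z) := by
    rw [blaschkeFactor, eq_div_iff hne, sub_mul, mul_assoc, div_mul_cancel₀ _ hne, mul_sub,
      blaschkePhase_mul]
    push_cast
    linear_combination (-z) * blaschkePhase_mul_norm a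
  have h1 := one_sub_le_norm_one_sub_conj_mul ha hz
  have h2 : ‖1 + blaschkePhase a * z‖ ≤ 2 := by
    refine (norm_add_le _ _).trans ?_
    rw [norm_one, norm_mul, norm_blaschkePhase]
    linarith
  have h3 : 0 ≤ 1 - ‖a‖ := by linarith [mem_ball_zero_iff.1 ha]
  rw [e, norm_div, norm_mul, norm_neg, Complex.norm_real, Real.norm_of_nonneg h3, div_mul_eq_mul_div,
    mul_comm 2]
  exact div_le_div₀ (by positivity) (by gcongr) (by linarith) h1

/-- Blaschke products: existence and modulus. -/
lemma exists_blaschkeProduct {ι : Type*} {a : ι → ℂ} (ha : ∀ i, a i ∈ unitDisk)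
    (hs : Summable fun i ↦ 1 - ‖a i‖) :
    ∃ B : ℂ → ℂ, DifferentiableOn ℂ B unitDisk ∧
      ∀ z ∈ unitDisk, HasProd (fun i ↦ pseudohyperbolicDist (a i) z) ‖B z‖ := by
  have key : ∀ r < 1, HasProdLocallyUniformlyOn (fun i z ↦ blaschkeFactor (a i) z)
      (fun z ↦ ∏' i, blaschkeFactor (a i) z) (ball 0 r) := by
    intro r hr
    have h := (hs.mul_left (2 / (1 - r))).hasProdLocallyUniformlyOn_one_add (K := ball (0 : ℂ) r)
      (f := fun i z ↦ blaschkeFactor (a i) z - 1) isOpen_ball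
      (Filter.Eventually.of_forall fun i z hz ↦
        norm_blaschkeFactor_sub_one_le (ha i) hr (mem_ball_zero_iff.1 hz).le)
      (fun i ↦ (((differentiableOn_blaschkeFactor (ha i)).continuousOn.mono
        (ball_subset_ball hr.le)).sub continuousOn_const))
    simpa only [add_sub_cancel] using h
  refine ⟨fun z ↦ ∏' i, blaschkeFactor (a i) z, ?_, fun z hz ↦ ?_⟩
  · refine differentiableOn_unitDisk_of_forall_lt fun r hr ↦ (key r hr).differentiableOn
      (.of_forall fun s ↦ ?_) isOpen_ball
    simpa [Finset.prod_fn] using DifferentiableOn.finsetProd fun i _ ↦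
      (differentiableOn_blaschkeFactor (ha i)).mono (ball_subset_ball hr.le)
  · obtain ⟨r, hzr, hr⟩ := exists_between (mem_ball_zero_iff.1 hz)
    simpa only [norm_blaschkeFactor] using
      ((key r hr).hasProd (mem_ball_zero_iff.2 hzr)).norm

/-! ### Harnack's inequality and harmonic functions as real parts. -/

/-- A Harnack inequality for positive harmonic functions given as real parts. -/
lemma re_le_of_pseudohyperbolicDist_le {g : ℂ → ℂ} (hg : DifferentiableOn ℂ g unitDisk)
    (hpos : ∀ z ∈ unitDisk, 0 < (g z).re) {a b : ℂ} (ha : a ∈ unitDisk) (hb : b ∈ unitDisk)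
    (hab : pseudohyperbolicDist a b ≤ 1 / 4) : (g a).re ≤ 5 / 3 * (g b).re := by
  set φ : ℂ → ℂ := fun z ↦ (a - z) / (1 - conj a * z) with hφ
  have hφd : DifferentiableOn ℂ φ unitDisk :=
    differentiableOn_div_one_sub_conj_mul ha (by fun_prop)
  have hφm : Set.MapsTo φ unitDisk unitDisk := fun z hz ↦
    mem_ball_zero_iff.2 (pseudohyperbolicDist_lt_one ha hz)
  have hφ0 : φ 0 = a := by simp [hφ]
  have hφb : φ (φ b) = b := by
    have h1 := one_sub_conj_mul_ne_zero ha hb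
    have h2 := one_sub_conj_mul_ne_zero ha ha
    have h3 := one_sub_conj_mul_ne_zero ha (hφm hb)
    have h4 : φ b * (1 - conj a * b) = a - b := div_mul_cancel₀ _ h1
    change (a - φ b) / (1 - conj a * φ b) = b
    rw [div_eq_iff h3]
    linear_combination h4 - 2 * h4
  have hne {x y : ℂ} (hx : 0 < x.re) (hy : 0 < y.re) : x + conj y ≠ 0 := fun h ↦ by
    have := congrArg Complex.re h
    simp at this
    linarith
  have hsq (x y : ℂ) : ‖x + conj y‖ ^ 2 = ‖x - y‖ ^ 2 + 4 * (x.re * y.re) := by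
    simp only [← Complex.normSq_eq_norm_sq, Complex.normSq_apply, Complex.sub_re, Complex.sub_im,
      Complex.add_re, Complex.add_im, Complex.conj_re, Complex.conj_im]
    ring
  -- Schwarz lemma for the Cayley transform of `g ∘ φ`, where the involution `φ` swaps 0 and `a`.
  have hT := Complex.norm_le_norm_of_mapsTo_ball (z := φ b) (R := 1)
    (f := fun z ↦ (g (φ z) - g a) / (g (φ z) + conj (g a)))
    (((hg.comp hφd hφm).sub_const _).div ((hg.comp hφd hφm).add_const _)
      fun z hz ↦ hne (hpos _ (hφm hz)) (hpos a ha))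
    (fun z hz ↦ by
      have h1 := hpos _ (hφm hz)
      have h2 := hpos a ha
      have h3 := norm_pos_iff.2 (hne h1 h2)
      rw [mem_closedBall_zero_iff, norm_div, div_le_one h3]
      have := hsq (g (φ z)) (g a)
      have := mul_pos h1 h2
      refine (sq_le_sq₀ (norm_nonneg _) (norm_nonneg _)).1 (by linarith))
    (by simp [hφ0]) (mem_ball_zero_iff.1 (hφm hb))
  have h1 := hpos b hb
  have h2 := hpos a ha
  have h3 := norm_pos_iff.2 (hne h1 h2)
  have h4 : ‖φ b‖ ≤ 1 / 4 := hab
  rw [hφb, norm_div, div_le_iff₀ h3] at hT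
  have h5 : ‖g b - g a‖ ≤ 1 / 4 * ‖g b + conj (g a)‖ := by nlinarith
  have h6 := pow_le_pow_left₀ (norm_nonneg _) h5 2
  have h7 := hsq (g b) (g a)
  have h8 : ((g b).re - (g a).re) ^ 2 ≤ ‖g b - g a‖ ^ 2 := by
    rw [← Complex.sub_re, ← sq_abs]
    exact pow_le_pow_left₀ (abs_nonneg _) (Complex.abs_re_le_norm _) 2
  -- With x, y the real parts at `b`, `a`: (x - y)² ≤ (4/15)xy, that is, (y - 5x/3)(y - 3x/5) ≤ 0.
  nlinarith

lemma isPosHarmonic_re {g : ℂ → ℂ} (hg : DifferentiableOn ℂ g unitDisk)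
    (hpos : ∀ z ∈ unitDisk, 0 ≤ (g z).re) : IsPosHarmonic fun z ↦ (g z).re :=
  ⟨fun _ hz ↦ (hg.analyticAt (isOpen_ball.mem_nhds hz)).harmonicAt_re, hpos⟩

lemma IsPosHarmonic.exists_re_eq {H : ℂ → ℝ} (hH : IsPosHarmonic H) :
    ∃ g : ℂ → ℂ, DifferentiableOn ℂ g unitDisk ∧ ∀ z ∈ unitDisk, (g z).re = H z := by
  obtain ⟨g, hg, h⟩ := hH.1.exists_analyticOnNhd_ball_re_eq
  exact ⟨g, hg.differentiableOn, h⟩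

/-! ### Interpolation by an explicit series. -/

/-- The real part of (1 + āz)/(1 - āz) is (1 - |az|²)/|1 - āz|², and |az| ≤ |a|. -/
lemma one_sub_norm_sq_sq_div_le_re {a z : ℂ} (ha : a ∈ unitDisk) (hz : z ∈ unitDisk) :
    ((1 - ‖a‖ ^ 2) / ‖1 - conj a * z‖) ^ 2 ≤
      ((1 - ‖a‖ ^ 2 : ℝ) * ((1 + conj a * z) / (1 - conj a * z)) : ℂ).re := by
  have hne := norm_pos_iff.2 (one_sub_conj_mul_ne_zero ha hz)
  have hq := one_sub_norm_sq_pos ha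
  have hre : ((1 + conj a * z) / (1 - conj a * z)).re =
      (1 - ‖a‖ ^ 2 * ‖z‖ ^ 2) / ‖1 - conj a * z‖ ^ 2 := by
    rw [Complex.div_re, ← add_div, Complex.normSq_eq_norm_sq, ← RCLike.norm_conj a, ← mul_pow,
      ← norm_mul, ← Complex.normSq_eq_norm_sq (conj a * z), Complex.normSq_apply]
    simp only [Complex.add_re, Complex.add_im, Complex.sub_re, Complex.sub_im, Complex.one_re,
      Complex.one_im]
    congr 1
    ring
  rw [Complex.re_ofReal_mul, hre, div_pow, sq (1 - ‖a‖ ^ 2), mul_div_assoc]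
  have : ‖a‖ ^ 2 * ‖z‖ ^ 2 ≤ ‖a‖ ^ 2 :=
    mul_le_of_le_one_right (by positivity) (by linarith [one_sub_norm_sq_pos hz])
  gcongr

/-- The series `∑ cₙ Bₙ(z) ((1 - |aₙ|²) / (1 - āₙ z))²` has a positive harmonic majorant. -/
lemma exists_holomorphic_eq_of_summable {a : ℕ → ℂ} (ha : ∀ n, a n ∈ unitDisk)
    (hs : Summable fun n ↦ 1 - ‖a n‖ ^ 2) {c : ℕ → ℂ} {B : ℕ → ℂ → ℂ}
    (hB : ∀ n, DifferentiableOn ℂ (B n) unitDisk)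
    (hcB : ∀ n, ∀ z ∈ unitDisk, ‖c n * B n z‖ ≤ 1)
    (hB0 : ∀ n m, m ≠ n → B n (a m) = 0) :
    ∃ F W : ℂ → ℂ, DifferentiableOn ℂ F unitDisk ∧ DifferentiableOn ℂ W unitDisk ∧
      (∀ z ∈ unitDisk, ‖F z‖ ≤ (W z).re) ∧ ∀ n, F (a n) = c n * B n (a n) := by
  set q : ℕ → ℝ := fun n ↦ 1 - ‖a n‖ ^ 2 with hq
  have hq0 n : 0 < q n := one_sub_norm_sq_pos (ha n)
  have hq1 n : q n ≤ 1 := sub_le_self _ (by positivity)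
  set F : ℕ → ℂ → ℂ := fun n z ↦ c n * B n z * ((q n : ℂ) / (1 - conj (a n) * z)) ^ 2 with hF
  set W : ℕ → ℂ → ℂ := fun n z ↦ (q n : ℂ) * ((1 + conj (a n) * z) / (1 - conj (a n) * z)) with hW
  have hFd n : DifferentiableOn ℂ (F n) unitDisk :=
    ((hB n).const_mul _).mul
      ((differentiableOn_div_one_sub_conj_mul (ha n) (by fun_prop)).pow 2)
  have hWd n : DifferentiableOn ℂ (W n) unitDisk :=
    (differentiableOn_div_one_sub_conj_mul (ha n) (by fun_prop)).const_mul _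
  have hF_le n z (hz : z ∈ unitDisk) : ‖F n z‖ ≤ (q n / ‖1 - conj (a n) * z‖) ^ 2 := by
    rw [hF, norm_mul, norm_pow, norm_div, Complex.norm_real, Real.norm_of_nonneg (hq0 n).le]
    exact mul_le_of_le_one_left (by positivity) (hcB n z hz)
  have hF_bound {r : ℝ} (hr : r < 1) n z (hz : z ∈ ball (0 : ℂ) r) :
      ‖F n z‖ ≤ q n * (1 / (1 - r) ^ 2) := by
    refine (hF_le n z (ball_subset_ball hr.le hz)).trans ?_
    have h1 := one_sub_le_norm_one_sub_conj_mul (ha n) (mem_ball_zero_iff.1 hz).le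
    have h2 : 0 < 1 - r := by linarith
    rw [div_pow, mul_one_div]
    have h3 : q n ^ 2 ≤ q n := by nlinarith [hq0 n, hq1 n]
    have := (hq0 n).le
    gcongr
  have hW_bound {r : ℝ} (hr : r < 1) n z (hz : z ∈ ball (0 : ℂ) r) :
      ‖W n z‖ ≤ q n * (2 / (1 - r)) := by
    have h1 := one_sub_le_norm_one_sub_conj_mul (ha n) (mem_ball_zero_iff.1 hz).le
    have h2 : 0 < 1 - r := by linarith
    rw [hW, norm_mul, norm_div, Complex.norm_real, Real.norm_of_nonneg (hq0 n).le]
    have h3 : ‖1 + conj (a n) * z‖ ≤ 2 := by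
      refine (norm_add_le _ _).trans ?_
      rw [norm_one, norm_mul, RCLike.norm_conj]
      nlinarith [mem_ball_zero_iff.1 (ha n), mem_ball_zero_iff.1 hz, norm_nonneg z,
        norm_nonneg (a n)]
    have := (hq0 n).le
    gcongr
  refine ⟨fun z ↦ ∑' n, F n z, fun z ↦ ∑' n, W n z, ?_, ?_, fun z hz ↦ ?_, fun m ↦ ?_⟩
  · exact differentiableOn_unitDisk_of_forall_lt fun r hr ↦
      Complex.differentiableOn_tsum_of_summable_norm (hs.mul_right _)
        (fun n ↦ (hFd n).mono (ball_subset_ball hr.le)) isOpen_ball (hF_bound hr)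
  · exact differentiableOn_unitDisk_of_forall_lt fun r hr ↦
      Complex.differentiableOn_tsum_of_summable_norm (hs.mul_right _)
        (fun n ↦ (hWd n).mono (ball_subset_ball hr.le)) isOpen_ball (hW_bound hr)
  · obtain ⟨r, hzr, hr⟩ := exists_between (mem_ball_zero_iff.1 hz)
    have hsum : Summable fun n ↦ W n z :=
      .of_norm_bounded (hs.mul_right _) fun n ↦ hW_bound hr n z (mem_ball_zero_iff.2 hzr)
    exact tsum_of_norm_bounded (Complex.hasSum_re hsum.hasSum) fun n ↦
      (hF_le n z hz).trans (one_sub_norm_sq_sq_div_le_re (ha n) hz)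
  · have hne : ((q m : ℝ) : ℂ) ≠ 0 := by exact_mod_cast (hq0 m).ne'
    have hqm : (1 : ℂ) - conj (a m) * a m = q m := by
      rw [Complex.conj_mul', hq]
      push_cast
      rfl
    change ∑' n, F n (a m) = _
    -- Only the term `m` survives at `a m`, and its kernel equals 1 there.
    rw [tsum_eq_single m fun n hn ↦ by simp [hF, hB0 n m hn.symm]]
    simp only [hF]
    rw [hqm, div_self hne, one_pow, mul_one]

/-- Positivity of one product makes 1 - ρ(a k, a 0) summable, and this controls 1 - |a k|² up to a
constant depending on `a 0`. -/
lemma summable_one_sub_norm_sq {a : ℕ → ℂ} (ha : ∀ n, a n ∈ unitDisk)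
    (hpos : 0 < blaschkeModulusOmit a 0) : Summable fun n ↦ 1 - ‖a n‖ ^ 2 := by
  have h := summable_one_sub_of_tprod_pos (fun _ ↦ pseudohyperbolicDist_nonneg _ _)
    (fun k : {k : ℕ // k ≠ 0} ↦ (pseudohyperbolicDist_lt_one (ha k) (ha 0)).le) hpos
  have h0 := one_sub_norm_sq_pos (ha 0)
  have h' : Summable fun k : {k : ℕ // k ≠ 0} ↦ 1 - ‖a k‖ ^ 2 := by
    refine .of_nonneg_of_le (fun k ↦ (one_sub_norm_sq_pos (ha k)).le) (fun k ↦ ?_)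
      (h.mul_left (8 / (1 - ‖a 0‖ ^ 2)))
    have hk := one_sub_norm_sq_pos (ha k)
    have hρ := pseudohyperbolicDist_lt_one (ha k) (ha 0)
    have hρ0 := pseudohyperbolicDist_nonneg (a k) (a 0)
    have hn := norm_pos_iff.2 (one_sub_conj_mul_ne_zero (ha k) (ha 0))
    have e := one_sub_pseudohyperbolicDist_sq (ha k) (ha 0)
    have hn2 : ‖1 - conj (a k) * a 0‖ ≤ 2 := by
      refine (norm_sub_le _ _).trans ?_
      rw [norm_one, norm_mul, RCLike.norm_conj]
      nlinarith [mem_ball_zero_iff.1 (ha k), mem_ball_zero_iff.1 (ha 0), norm_nonneg (a k),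
        norm_nonneg (a 0)]
    rw [eq_div_iff (by positivity)] at e
    rw [div_mul_eq_mul_div, le_div_iff₀ h0, ← e]
    have h1 : 1 - pseudohyperbolicDist (a k) (a 0) ^ 2 ≤
        2 * (1 - pseudohyperbolicDist (a k) (a 0)) := by nlinarith
    have h2 : ‖1 - conj (a k) * a 0‖ ^ 2 ≤ 4 := by nlinarith
    nlinarith [mul_le_mul h1 h2 (by positivity) (by linarith)]
  exact ((Set.finite_singleton 0).summable_compl_iff).1 h'

/-- The interpolant is `exp G * F`: dividing the data by `exp G` leaves coefficients that the series
can handle. -/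
lemma mem_nevanlinnaTrace_of_norm_le {a : ℕ → ℂ} (ha : ∀ n, a n ∈ unitDisk) {G : ℂ → ℂ}
    (hG : DifferentiableOn ℂ G unitDisk) (hGpos : ∀ z ∈ unitDisk, 0 ≤ (G z).re)
    (hpos : ∀ n, 0 < blaschkeModulusOmit a n) {w : ℕ → ℂ}
    (hw : ∀ n, ‖w n‖ ≤ Real.exp (G (a n)).re * blaschkeModulusOmit a n) :
    w ∈ nevanlinnaTrace a := by
  have hs := summable_one_sub_norm_sq ha (hpos 0)
  have hs1 : Summable fun n ↦ 1 - ‖a n‖ :=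
    .of_nonneg_of_le (fun n ↦ by linarith [mem_ball_zero_iff.1 (ha n)])
      (fun n ↦ by nlinarith [mem_ball_zero_iff.1 (ha n), norm_nonneg (a n)]) hs
  choose B hBd hB using fun n ↦ exists_blaschkeProduct (a := fun k : {k : ℕ // k ≠ n} ↦ a k)
    (fun k ↦ ha k) (hs1.comp_injective Subtype.val_injective)
  have hBn n : ‖B n (a n)‖ = blaschkeModulusOmit a n := (hB n _ (ha n)).tprod_eq.symm
  have hB1 n z (hz : z ∈ unitDisk) : ‖B n z‖ ≤ 1 :=
    hasProd_le_of_prod_le (hB n z hz) fun s ↦ Finset.prod_le_one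
      (fun _ _ ↦ pseudohyperbolicDist_nonneg _ _)
      fun k _ ↦ (pseudohyperbolicDist_lt_one (ha k) hz).le
  have hB0 n m (h : m ≠ n) : B n (a m) = 0 := by
    rw [← norm_le_zero_iff, ← (hB n _ (ha m)).tprod_eq]
    refine (tprod_le_apply (fun _ ↦ pseudohyperbolicDist_nonneg _ _)
      (fun k : {k : ℕ // k ≠ n} ↦ (pseudohyperbolicDist_lt_one (ha k) (ha m)).le) ⟨m, h⟩).trans ?_
    simp [pseudohyperbolicDist]
  have hBne n : B n (a n) ≠ 0 := norm_pos_iff.1 ((hBn n).symm ▸ hpos n)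
  obtain ⟨F, W, hF, hW, hFW, hFa⟩ := exists_holomorphic_eq_of_summable ha hs
    (c := fun n ↦ w n / (Complex.exp (G (a n)) * B n (a n))) hBd (fun n z hz ↦ by
      rw [norm_mul, norm_div, norm_mul, Complex.norm_exp, hBn]
      exact mul_le_one₀ (div_le_one_of_le₀ (hw n) (mul_pos (Real.exp_pos _) (hpos n)).le)
        (norm_nonneg _) (hB1 n z hz)) hB0
  have hW0 z (hz : z ∈ unitDisk) : 0 ≤ (W z).re := (norm_nonneg _).trans (hFW z hz)
  refine ⟨fun z ↦ Complex.exp (G z) * F z, ⟨hG.cexp.mul hF, fun z ↦ (G z + W z).re,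
    isPosHarmonic_re (hG.add hW) fun z hz ↦ ?_, fun z hz ↦ ?_⟩, fun n ↦ ?_⟩
  · exact add_nonneg (hGpos z hz) (hW0 z hz)
  · change Real.posLog ‖Complex.exp (G z) * F z‖ ≤ (G z + W z).re
    rw [norm_mul, Complex.add_re, Complex.norm_exp]
    refine Real.posLog_mul.trans (add_le_add ?_ ?_)
    · rw [Real.posLog, Real.log_exp, sup_of_le_right (hGpos z hz)]
    · refine sup_le (hW0 z hz) ?_
      exact (Real.log_le_self (norm_nonneg _)).trans (hFW z hz)
  · change w n = Complex.exp (G (a n)) * F (a n)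
    rw [hFa]
    field_simp [hBne n, Complex.exp_ne_zero]

/-- A sequence whose Blaschke products are bounded below, at the omitted zeros, by `exp (-H)` with
`H` positive harmonic is interpolating for the Nevanlinna class. -/
lemma isNevanlinnaInterpolating_of_exp_neg_le {a : ℕ → ℂ} (ha : ∀ n, a n ∈ unitDisk) {H : ℂ → ℝ}
    (hH : IsPosHarmonic H) (haH : ∀ n, Real.exp (-H (a n)) ≤ blaschkeModulusOmit a n) :
    IsNevanlinnaInterpolating a := by
  refine ⟨ha, ?_⟩
  rintro v ⟨C, hv⟩ w ⟨f, ⟨-, K, hK, hfK⟩, hwf⟩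
  have hC : 0 ≤ C := (norm_nonneg _).trans (hv 0)
  obtain ⟨g, hg, hgH⟩ := hH.exists_re_eq
  obtain ⟨k, hk, hkK⟩ := hK.exists_re_eq
  have hre z (hz : z ∈ unitDisk) : ((C : ℂ) + k z + g z).re = C + K z + H z := by
    simp [hgH z hz, hkK z hz]
  -- In the exponent, `C` absorbs the multiplier, `k` the growth of `f`, and `g` the smallness of
  -- the product.
  refine mem_nevanlinnaTrace_of_norm_le ha (G := fun z ↦ C + k z + g z)
    ((hk.const_add _).add hg) (fun z hz ↦ ?_) (fun n ↦ (Real.exp_pos _).trans_le (haH n))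
    fun n ↦ ?_
  · rw [hre z hz]
    have := hH.2 z hz
    have := hK.2 z hz
    positivity
  · have hw : ‖w n‖ ≤ Real.exp (K (a n)) := by
      rw [hwf]
      refine (Real.le_exp_log _).trans (Real.exp_le_exp.2 (le_sup_right.trans (hfK _ (ha n))))
    have hvn : ‖v n‖ ≤ Real.exp C := (hv n).trans (by linarith [Real.add_one_le_exp C])
    calc ‖v n * w n‖ ≤ Real.exp C * Real.exp (K (a n)) := by
          rw [norm_mul]
          gcongr
      _ = Real.exp (C + K (a n) + H (a n)) * Real.exp (-H (a n)) := by
          rw [← Real.exp_add, ← Real.exp_add]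
          congr 1
          ring
      _ ≤ _ := by
          rw [hre _ (ha n)]
          gcongr
          exact haH n

/-! ### Transfer of the lower bound to the perturbed sequence. -/

theorem corollary2p3 (Λ Λ' : ℕ → ℂ) (H : ℂ → ℝ)
    (hΛ : IsNevanlinnaInterpolating Λ)
    (hH : IsPosHarmonic H)
    (hΛH : ∀ n, Real.exp (-H (Λ n)) ≤ blaschkeModulusOmit Λ n)
    (hΛ' : ∀ n, Λ' n ∈ unitDisk)
    (hclose : ∀ n, pseudohyperbolicDist (Λ n) (Λ' n) ≤ 1 / 4 * Real.exp (-H (Λ n))) :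
    IsNevanlinnaInterpolating Λ' := by
  have hD := hΛ.1
  obtain ⟨g, hg, hgH⟩ := hH.exists_re_eq
  have hρ {k n : ℕ} (h : k ≠ n) :
      Real.exp (-H (Λ n)) ≤ pseudohyperbolicDist (Λ k) (Λ n) :=
    (hΛH n).trans <| tprod_le_apply (fun _ ↦ pseudohyperbolicDist_nonneg _ _)
      (fun k : {k : ℕ // k ≠ n} ↦ (pseudohyperbolicDist_lt_one (hD k) (hD n)).le) ⟨k, h⟩
  have hprod n : blaschkeModulusOmit Λ n ^ 8 ≤ blaschkeModulusOmit Λ' n := by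
    refine tprod_pow_le_tprod (fun _ ↦ pseudohyperbolicDist_nonneg _ _)
      (fun k : {k : ℕ // k ≠ n} ↦ (pseudohyperbolicDist_lt_one (hD k) (hD n)).le)
      (fun k ↦ (pseudohyperbolicDist_lt_one (hΛ' k) (hΛ' n)).le) 8 fun k ↦ ?_
    have h1 := hρ k.2
    have h2 := hρ k.2.symm
    rw [pseudohyperbolicDist_comm] at h2
    have h3 := hclose k
    have h4 := hclose n
    exact pseudohyperbolicDist_pow_eight_le (hD k) (hD n) (hΛ' k) (hΛ' n) (by linarith)
      (by linarith)
  -- Harnack is applied to `H + 1`, which is strictly positive.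
  have harnack n : H (Λ n) ≤ 5 / 3 * H (Λ' n) + 1 := by
    have hre z (hz : z ∈ unitDisk) : (g z + 1).re = H z + 1 := by simp [hgH z hz]
    have := re_le_of_pseudohyperbolicDist_le (hg.add_const 1)
      (fun z hz ↦ by
        have := hH.2 z hz
        rw [hre z hz]
        linarith) (hD n) (hΛ' n)
      ((hclose n).trans (by
        have := Real.exp_le_one_iff.2 (neg_nonpos.2 (hH.2 _ (hD n)))
        linarith))
    rw [hre _ (hD n), hre _ (hΛ' n)] at this
    linarith
  -- 8(5H/3 + 1) ≤ 14H + 8, since `H` is nonnegative.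
  have hre z (hz : z ∈ unitDisk) : (((14 : ℝ) : ℂ) * g z + 8).re = 14 * H z + 8 := by
    rw [Complex.add_re, Complex.re_ofReal_mul, hgH z hz]
    simp
  refine isNevanlinnaInterpolating_of_exp_neg_le hΛ'
    (isPosHarmonic_re ((hg.const_mul ((14 : ℝ) : ℂ)).add_const 8) fun z hz ↦ ?_) fun n ↦ ?_
  · have := hH.2 z hz
    rw [hre z hz]
    positivity
  · refine le_trans ?_ ((pow_le_pow_left₀ (Real.exp_pos _).le (hΛH n) 8).trans (hprod n))
    rw [hre _ (hΛ' n), ← Real.exp_nat_mul, Real.exp_le_exp]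
    have := harnack n
    have := hH.2 _ (hΛ' n)
    push_cast
    linarith
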